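/- **Setting.** A hidden state $Y$ takes values in a finite set $\mathcal Y$ with a known prior. There are finitely many tests $t\in\mathcal T$ with binary outcomes $X_t$ that are conditionally independent given $Y$, with known probabilities $\Pr(X_t=1\mid Y=y)$, and with costs $c(t)\ge 0$. A hypothesis $h\in\{0,1\}^{\mathcal T}$ is a full vector of test outcomes, with probability $p(h)=\sum_y \Pr(y)\prod_t\Pr(X_t=h_t\mid y)$. There are finitely many decisions $d$ with utilities $u(d,y)\in[0,1]$; the region $\mathcal R_d$ is the set of hypotheses $h$ with $p(h)>0$ for which $d$ maximizes $\mathbb E[u(d,Y)\mid h]$. The regions are assumed to be pairwise disjoint. An edge is an unordered pair of hypotheses $\{h,h'\}$ that lie in the regions of two different decisions; its weight is $p(h)p(h')$. An observation vector $\mathbf x_{\mathcal A}$ (the outcomes of a set $\mathcal A$ of tests) cuts an edge if at least one endpoint is inconsistent with $\mathbf x_{\mathcal A}$. The EC² objective $f(\mathbf x_{\mathcal A})$ is the total weight of the edges cut by $\mathbf x_{\mathcal A}$. For a set $S$ of hypotheses, $\Delta_S(t\mid\mathbf x_{\mathcal A})$ is the expected increase, over the outcome $x_t$ with its exact conditional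 probability $p(x_t\mid\mathbf x_{\mathcal A})$, of the total weight of the cut edges with both endpoints in $S$, when $t$ is performed after $\mathbf x_{\mathcal A}$. A policy is a partial map from the current observations to the next, not yet performed, test. The policy $\pi_{[b]}$ with budget $b$ runs $\pi$ as long as the next test fits into the remaining budget; if the next test $t$ does not fit into the remaining budget $r<c(t)$, it is performed as the last test with probability $r/c(t)$. (With unit costs and an integer $b$ these are just the first $b$ tests of $\pi$.) Let $f_{avg}(\pi_{[b]})$ be the expected value, over $h\sim p$ and this randomization, of $f$ at the observations made by $\pi_{[b]}$. **Re-sampling and the greedy policy.** Let $\eta\in\mathbb R$. After each observation vector $\mathbf x_{\mathcal A}$ a set $\tilde{\mathcal H}=\tilde{\mathcal H}(\mathbf x_{\mathcal A})$ of hypotheses is generated whose consistent members satisfy $p(\tilde{\mathcal H},\mathbf x_{\mathcal A})\ge(1-\eta)\,p(\mathbf x_{\mathcal A})$. Let $\pi^g_{\tilde{\mathcal H}}$ be a greedy EC² policy: after $\mathbf x_{\mathcal A}$ it performs a remaining test $t$ with maximal gain per unit cost $\Delta_{\tilde{\mathcal H}}(t\mid\mathbf x_{\mathcal A})/c(t)$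 (ties broken arbitrarily; if costs may vanish, this means $\Delta_{\tilde{\mathcal H}}(s\mid\mathbf x_{\mathcal A})\,c(t)\le\Delta_{\tilde{\mathcal H}}(t\mid\mathbf x_{\mathcal A})\,c(s)$ for all remaining tests $s$), and it stops only if no remaining test has positive gain on $\tilde{\mathcal H}(\mathbf x_{\mathcal A})$. **Theorem.** Let $k,\ell$ be positive integers. A policy $\pi^*$ that maximizes $f_{avg}(\pi_{[k]})$ over all policies $\pi$ exists, and for each such policy, writing $\pi^*_{\mathcal H,[k]}=\pi^*_{[k]}$ and $\pi^g_{\tilde{\mathcal H},[\ell]}$ for $\pi^g_{\tilde{\mathcal H}}$ with budget $\ell$, $$f_{avg}\big(\pi^g_{\tilde{\mathcal H},[\ell]}\big)\ \ge\ \big(1-e^{-\ell/k}\big)\,f_{avg}\big(\pi^*_{\mathcal H,[k]}\big)-k\epsilon,\qquad \epsilon=2\eta\Big(1-\Big(1-\frac1k\Big)^{\ell}\Big).$$ If $k\ge 2$, the same bound holds with $\epsilon=2\eta\big(1-(1/k)^{\ell}\big)$. -/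

import Mathlib

/-- A value-of-information problem: a hidden state in `Y` with a given prior, tests `T` with binary
outcomes that are conditionally independent given the hidden state, decisions `D` with utilities
in `[0, 1]`, and nonnegative test costs. `θ t y` is the probability that test `t` has outcome `1`
(`true`) when the hidden state is `y`. -/
structure VoIModel (Y T D : Type*) [Fintype Y] where
  prior : Y → ℝ
  prior_nonneg : ∀ y, 0 ≤ prior y
  prior_sum : ∑ y, prior y = 1
  θ : T → Y → ℝ
  θ_nonneg : ∀ t y, 0 ≤ θ t y
  θ_le_one : ∀ t y, θ t y ≤ 1
  u : D → Y → ℝ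
  u_nonneg : ∀ d y, 0 ≤ u d y
  u_le_one : ∀ d y, u d y ≤ 1
  cost : T → ℝ
  cost_nonneg : ∀ t, 0 ≤ cost t

/-- A hypothesis is a full vector of test outcomes. -/
abbrev Hyp (T : Type*) := T → Bool

/-- An observation vector: `x t = none` if test `t` has not been performed, and `x t = some b`
if it has been performed with outcome `b`. -/
abbrev Obs (T : Type*) := T → Option Bool

/-- The observation vector before any test has been performed. -/
def Obs.empty (T : Type*) : Obs T := fun _ => none

/-- The observation vector `x` extended by the outcome `b` of test `t`. -/
def Obs.extend {T : Type*} [DecidableEq T] (x : Obs T) (t : T) (b : Bool) : Obs T :=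
  Function.update x t (some b)

/-- The hypothesis `h` agrees with all observed outcomes in `x`. -/
def Obs.Consistent {T : Type*} (x : Obs T) (h : Hyp T) : Prop :=
  ∀ t b, x t = some b → h t = b

/-- A (deterministic, adaptive) policy: a partial map from the observations made so far to the next
test, which is one that has not been performed yet; `none` means that the policy stops. -/
structure Policy (T : Type*) where
  next : Obs T → Option T
  fresh : ∀ x t, next x = some t → x t = none

namespace VoIModel

noncomputable section

open scoped Classical

variable {Y T D : Type*} [Fintype Y] [Fintype T] [DecidableEq T] [Fintype D]

/-- Conditional probability of the outcome vector `h` given the hidden state `y`. -/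
def condProb (M : VoIModel Y T D) (h : Hyp T) (y : Y) : ℝ :=
  ∏ t, if h t = true then M.θ t y else 1 - M.θ t y

/-- Probability of the hypothesis `h`. -/
def prob (M : VoIModel Y T D) (h : Hyp T) : ℝ :=
  ∑ y, M.prior y * M.condProb h y

/-- Expected utility of the decision `d` given that the hypothesis `h` is the true one. -/
def expUtil (M : VoIModel Y T D) (d : D) (h : Hyp T) : ℝ :=
  ∑ y, (M.prior y * M.condProb h y / M.prob h) * M.u d y

/-- The value of observing all outcomes in `h`: the maximal expected utility of a decision. -/
def value (M : VoIModel Y T D) (h : Hyp T) : ℝ :=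
  ⨆ d, M.expUtil d h

/-- The decision region of `d`: the possible (positive probability) hypotheses for which `d` is an
optimal decision. -/
def region (M : VoIModel Y T D) (d : D) : Set (Hyp T) :=
  {h | 0 < M.prob h ∧ M.expUtil d h = M.value h}

/-- `{h, h'}` is an edge: the two hypotheses lie in the regions of two different decisions. -/
def IsEdge (M : VoIModel Y T D) (h h' : Hyp T) : Prop :=
  ∃ d d', d ≠ d' ∧ h ∈ M.region d ∧ h' ∈ M.region d'

/-- Total weight of the edges `{h, h'}` between hypotheses of `S` that are cut by `x`, that is, at
least one of whose endpoints is inconsistent with `x`; the weight of `{h, h'}` is the product of the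
probabilities of `h` and `h'`. The sum is over ordered pairs, hence the factor `1 / 2`. -/
def cutWeight (M : VoIModel Y T D) (S : Finset (Hyp T)) (x : Obs T) : ℝ :=
  (1 / 2) * ∑ h ∈ S, ∑ h' ∈ S,
    if M.IsEdge h h' ∧ ¬ (x.Consistent h ∧ x.Consistent h') then M.prob h * M.prob h' else 0

/-- The EC² objective: the total weight of the edges cut by `x`. -/
def ec2 (M : VoIModel Y T D) (x : Obs T) : ℝ :=
  M.cutWeight Finset.univ x

/-- Joint probability of the set `S` of hypotheses and the observations `x`. -/
def jointProb (M : VoIModel Y T D) (S : Finset (Hyp T)) (x : Obs T) : ℝ :=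
  ∑ h ∈ S, if x.Consistent h then M.prob h else 0

/-- Probability of the observations `x`. -/
def obsProb (M : VoIModel Y T D) (x : Obs T) : ℝ :=
  M.jointProb Finset.univ x

/-- Expected gain, after the observations `x`, of performing test `t`, in the EC² objective
restricted to the hypotheses in `S`. The outcome probabilities are the exact ones, computed from
the model. -/
def gain (M : VoIModel Y T D) (S : Finset (Hyp T)) (x : Obs T) (t : T) : ℝ :=
  ∑ b : Bool, (M.obsProb (x.extend t b) / M.obsProb x) *
    (M.cutWeight S (x.extend t b) - M.cutWeight S x)

/-- The sampled sets `S x`, re-generated after each observation, keep `1 - η` posterior coverage: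
after the observations `x`, the set `S x` carries at least a `1 - η` fraction of the mass that is
consistent with `x`. -/
def Covers (M : VoIModel Y T D) (η : ℝ) (S : Obs T → Finset (Hyp T)) : Prop :=
  ∀ x, (1 - η) * M.obsProb x ≤ M.jointProb (S x) x

/-- `π` is a greedy EC² policy on the re-sampled sets `S`: after the observations `x` it performs
a not yet performed test with maximal gain per unit cost on `S x` (`gain t / cost t`, written
without division because costs may vanish), with arbitrary tie-breaking, and it stops only if no
remaining test has positive gain on `S x`. -/
def IsGreedy (M : VoIModel Y T D) (S : Obs T → Finset (Hyp T)) (π : Policy T) : Prop :=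
  ∀ x, (∀ t, π.next x = some t → ∀ s, x s = none →
      M.gain (S x) x s * M.cost t ≤ M.gain (S x) x t * M.cost s) ∧
    (π.next x = none → ∀ s, x s = none → M.gain (S x) x s ≤ 0)

/-- Utility, if the true hypothesis is `h`, of continuing with the policy `π` after the
observations `x` when the remaining budget is `r`, with at most `n` further tests. If the next test
`t` fits into the remaining budget, it is performed; if not, it is performed with probability
`r / cost t` as the last test (and the expectation over this choice is taken). -/
def runUtil (M : VoIModel Y T D) (π : Policy T) (h : Hyp T) : ℕ → ℝ → Obs T → ℝ
  | 0, _, x => M.ec2 x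
  | n + 1, r, x =>
    match π.next x with
    | none => M.ec2 x
    | some t =>
      if M.cost t ≤ r then runUtil M π h n (r - M.cost t) (x.extend t (h t))
      else (1 - r / M.cost t) * M.ec2 x + (r / M.cost t) * M.ec2 (x.extend t (h t))

/-- Expected EC² utility `f_avg(π_[b])`, with respect to the true distribution, of the policy `π`
with budget `b`. As no test is performed twice, there are at most `card T` tests in a run. -/
def favg (M : VoIModel Y T D) (π : Policy T) (b : ℝ) : ℝ :=
  ∑ h, M.prob h * M.runUtil π h (Fintype.card T) b (Obs.empty T)

/-- `π` has the maximal expected EC² utility under budget `b` on the true distribution. -/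
def IsOptimal (M : VoIModel Y T D) (b : ℝ) (π : Policy T) : Prop :=
  ∀ π' : Policy T, M.favg π' b ≤ M.favg π b

end

end VoIModel

/-! Two possible hypotheses fail to form an edge only if no two different decisions separate them,
so every possible hypothesis is joined to an endpoint of every edge (`IsEdge.left_or_right`).
Averaging this over a larger set shows that the edge weight inside `A`, divided by the mass of `A`,
grows with `A` (`pairSum_mul_mass_le`). This density bound replaces exact adaptive submodularity: if
`S` carries a `1 - η` fraction of the mass of `A`, restricting from `A` to any subset increases the
normalized gain on `S` by a factor of at most `1 / (1 - η)` (`splitGain_subset`).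

Let `x` be the observations of the greedy policy and `ρ` its best sampled gain per unit cost.
Running a competing policy from scratch on the hypotheses consistent with `x` only meets subsets of
`consistentSet x`, so with budget `k` it ends at most `k * ρ + 2 * η` above `ec2 x` in expectation
(`sum_consistentSet_runUtil_le`). The true gain of the greedy test is at least the sampled one,
since splitting removes more edges if more edges count (`obsProb_mul_ec2_add_gain`). Spending `c`
therefore closes at least a fraction `1 - exp (-c / k)` of the remaining deficit whenever that is
positive, and induction along the run (`sum_runUtil_greedy_ge`) gives the factor `1 - exp (-l / k)`
with the error `2 * η * (1 - exp (-l / k))`, which is smaller than both claimed errors. -/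

set_option linter.unusedSectionVars false

/-! ### Edge weights and expected reductions in an abstract weighted graph. -/

section PairSums

variable {H : Type*}

/-- Total weight of the pairs in `A ×ˢ B` under the pair weight `e`. -/
def pairSum (e : H → H → ℝ) (A B : Finset H) : ℝ := ∑ h ∈ A, ∑ h' ∈ B, e h h'

theorem pairSum_nonneg {e : H → H → ℝ} (he : ∀ h h', 0 ≤ e h h') (A B : Finset H) :
    0 ≤ pairSum e A B :=
  Finset.sum_nonneg fun _ _ => Finset.sum_nonneg fun _ _ => he _ _

theorem pairSum_mono {e : H → H → ℝ} (he : ∀ h h', 0 ≤ e h h') {A A' B B' : Finset H}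
    (hA : A' ⊆ A) (hB : B' ⊆ B) : pairSum e A' B' ≤ pairSum e A B :=
  (Finset.sum_le_sum fun _ _ => Finset.sum_le_sum_of_subset_of_nonneg hB fun _ _ _ => he _ _).trans
    (Finset.sum_le_sum_of_subset_of_nonneg hA fun _ _ _ => Finset.sum_nonneg fun _ _ => he _ _)

theorem pairSum_comm {e : H → H → ℝ} (hsymm : ∀ h h', e h h' = e h' h) (A B : Finset H) :
    pairSum e A B = pairSum e B A := by
  unfold pairSum
  rw [Finset.sum_comm]
  exact Finset.sum_congr rfl fun _ _ => Finset.sum_congr rfl fun _ _ => hsymm _ _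

theorem pairSum_filter_left (e : H → H → ℝ) (A B : Finset H) (P : H → Prop) [DecidablePred P] :
    pairSum e A B = pairSum e (A.filter P) B + pairSum e (A.filter fun h => ¬ P h) B :=
  (Finset.sum_filter_add_sum_filter_not A P _).symm

theorem pairSum_filter_right (e : H → H → ℝ) (A B : Finset H) (P : H → Prop) [DecidablePred P] :
    pairSum e A B = pairSum e A (B.filter P) + pairSum e A (B.filter fun h => ¬ P h) := by
  unfold pairSum
  rw [← Finset.sum_add_distrib]
  exact Finset.sum_congr rfl fun _ _ => (Finset.sum_filter_add_sum_filter_not B P _).symm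

theorem pairSum_le_mul {e : H → H → ℝ} {p : H → ℝ} (hle : ∀ h h', e h h' ≤ p h * p h')
    (A B : Finset H) : pairSum e A B ≤ (∑ h ∈ A, p h) * ∑ h ∈ B, p h := by
  rw [Finset.sum_mul_sum]
  exact Finset.sum_le_sum fun _ _ => Finset.sum_le_sum fun _ _ => hle _ _

/-- If every vertex is joined to an endpoint of every edge, then the edges inside `A` are
controlled by those between `J` and `A`. -/
theorem mass_mul_pairSum_le {e : H → H → ℝ} {p : H → ℝ}
    (hkey : ∀ j h h', p j * e h h' ≤ p h' * e j h + p h * e j h') (J A : Finset H) :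
    (∑ j ∈ J, p j) * pairSum e A A ≤ 2 * ((∑ h ∈ A, p h) * pairSum e J A) := by
  have h1 : (∑ j ∈ J, p j) * pairSum e A A =
      ∑ j ∈ J, ∑ h ∈ A, ∑ h' ∈ A, p j * e h h' := by
    rw [Finset.sum_mul]
    exact Finset.sum_congr rfl fun j _ => by simp only [pairSum, Finset.mul_sum]
  have h2 : (∑ h ∈ A, p h) * pairSum e J A = ∑ j ∈ J, ∑ h ∈ A, ∑ h' ∈ A, p h' * e j h := by
    unfold pairSum
    rw [Finset.mul_sum]
    refine Finset.sum_congr rfl fun j _ => ?_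
    rw [Finset.mul_sum]
    exact Finset.sum_congr rfl fun h _ => Finset.sum_mul _ _ _
  -- Exchanging `h` and `h'` gives a second form of the same product; `h2` and `h3` match the two
  -- terms on the right of `hkey`.
  have h3 : (∑ h ∈ A, p h) * pairSum e J A = ∑ j ∈ J, ∑ h ∈ A, ∑ h' ∈ A, p h * e j h' := by
    rw [h2]
    exact Finset.sum_congr rfl fun j _ => Finset.sum_comm
  rw [two_mul, h1]
  nth_rewrite 1 [h2]
  rw [h3, ← Finset.sum_add_distrib]
  refine Finset.sum_le_sum fun j _ => ?_
  rw [← Finset.sum_add_distrib]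
  refine Finset.sum_le_sum fun h _ => ?_
  rw [← Finset.sum_add_distrib]
  exact Finset.sum_le_sum fun h' _ => hkey _ _ _

/-- The ratio of edge weight to mass is monotone in the set. With `J = A \ A'` it suffices that `J`
has at least its share of edges, and those between `J` and `A'` already provide it by
`mass_mul_pairSum_le`. -/
theorem pairSum_mul_mass_le [DecidableEq H] {e : H → H → ℝ} {p : H → ℝ}
    (hp : ∀ h, 0 ≤ p h) (he : ∀ h h', 0 ≤ e h h')
    (hsymm : ∀ h h', e h h' = e h' h)
    (hkey : ∀ j h h', p j * e h h' ≤ p h' * e j h + p h * e j h')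
    {A' A : Finset H} (hA : A' ⊆ A) :
    pairSum e A' A' * (∑ h ∈ A, p h) ≤ pairSum e A A * ∑ h ∈ A', p h := by
  have hf : A.filter (· ∈ A') = A' := by
    rw [Finset.filter_mem_eq_inter, Finset.inter_eq_right.2 hA]
  set J := A.filter fun h => ¬ h ∈ A'
  have h1 : pairSum e A A = pairSum e A' A' + pairSum e A' J + (pairSum e J A' + pairSum e J J) := by
    rw [pairSum_filter_left e A A (· ∈ A'), pairSum_filter_right e (A.filter (· ∈ A')) A (· ∈ A'),
      pairSum_filter_right e (A.filter fun h => ¬ h ∈ A') A (· ∈ A'), hf]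
  have h2 : ∑ h ∈ A, p h = ∑ h ∈ A', p h + ∑ h ∈ J, p h := by
    rw [← Finset.sum_filter_add_sum_filter_not A (· ∈ A'), hf]
  have h3 := mass_mul_pairSum_le hkey J A'
  have h4 := pairSum_comm hsymm A' J
  have h5 : 0 ≤ pairSum e J J * ∑ h ∈ A', p h :=
    mul_nonneg (pairSum_nonneg he _ _) (Finset.sum_nonneg fun _ _ => hp _)
  rw [h1, h2, h4]
  nlinarith

/-- Expected reduction (times twice the total mass) of the weight of the edges inside `S` when the
set `B` is split according to `q`. -/
def splitGain [DecidableEq H] (e : H → H → ℝ) (p : H → ℝ) (S B : Finset H) (q : H → Bool) : ℝ :=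
  (∑ h ∈ B, p h) * pairSum e (B ∩ S) (B ∩ S) -
    ∑ b : Bool, (∑ h ∈ B.filter (q · = b), p h) *
      pairSum e (B.filter (q · = b) ∩ S) (B.filter (q · = b) ∩ S)

theorem sum_filter_bool (f : H → ℝ) (B : Finset H) (q : H → Bool) :
    ∑ h ∈ B, f h = ∑ h ∈ B.filter (q · = true), f h + ∑ h ∈ B.filter (q · = false), f h := by
  rw [← Finset.sum_filter_add_sum_filter_not B (q · = true)]
  simp

/-- A pair inside one half is lost when the other outcome occurs, a pair across the halves is always
lost. All terms are nonnegative here, so monotonicity can be checked term by term. -/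
theorem splitGain_eq [DecidableEq H] {e : H → H → ℝ} (hsymm : ∀ h h', e h h' = e h' h)
    (p : H → ℝ) (S B : Finset H) (q : H → Bool) :
    splitGain e p S B q =
      (∑ h ∈ B.filter (q · = false), p h) *
          pairSum e (B.filter (q · = true) ∩ S) (B.filter (q · = true) ∩ S) +
        (∑ h ∈ B.filter (q · = true), p h) *
          pairSum e (B.filter (q · = false) ∩ S) (B.filter (q · = false) ∩ S) +
        2 * (∑ h ∈ B, p h) *
          pairSum e (B.filter (q · = true) ∩ S) (B.filter (q · = false) ∩ S) := by
  have hS : ∀ b, (B ∩ S).filter (q · = b) = B.filter (q · = b) ∩ S := fun b => by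
    ext h; simp only [Finset.mem_filter, Finset.mem_inter]; tauto
  have hn : (B ∩ S).filter (fun h => ¬ q h = true) = B.filter (q · = false) ∩ S := by
    rw [← hS]; simp
  have h1 := pairSum_filter_left e (B ∩ S) (B ∩ S) (q · = true)
  rw [pairSum_filter_right e ((B ∩ S).filter (q · = true)) (B ∩ S) (q · = true),
    pairSum_filter_right e ((B ∩ S).filter fun h => ¬ q h = true) (B ∩ S) (q · = true), hn, hS] at h1
  have h2 := pairSum_comm hsymm (B.filter (q · = false) ∩ S) (B.filter (q · = true) ∩ S)
  unfold splitGain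
  rw [h1, h2, Fintype.sum_bool, sum_filter_bool p B q]
  ring

theorem splitGain_nonneg [DecidableEq H] {e : H → H → ℝ} {p : H → ℝ} (hp : ∀ h, 0 ≤ p h)
    (he : ∀ h h', 0 ≤ e h h') (hsymm : ∀ h h', e h h' = e h' h) (S B : Finset H) (q : H → Bool) :
    0 ≤ splitGain e p S B q := by
  rw [splitGain_eq hsymm]
  have hm : ∀ A : Finset H, 0 ≤ ∑ h ∈ A, p h := fun A => Finset.sum_nonneg fun _ _ => hp _
  have := fun A B => pairSum_nonneg he A B
  exact add_nonneg (add_nonneg (mul_nonneg (hm _) (this _ _)) (mul_nonneg (hm _) (this _ _)))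
    (mul_nonneg (mul_nonneg zero_le_two (hm _)) (this _ _))

theorem splitGain_mono_left [DecidableEq H] {e : H → H → ℝ} {p : H → ℝ} (hp : ∀ h, 0 ≤ p h)
    (he : ∀ h h', 0 ≤ e h h') (hsymm : ∀ h h', e h h' = e h' h) {S S' : Finset H} (hS : S ⊆ S')
    (B : Finset H) (q : H → Bool) :
    splitGain e p S B q ≤ splitGain e p S' B q := by
  rw [splitGain_eq hsymm, splitGain_eq hsymm]
  have hm : ∀ A : Finset H, 0 ≤ ∑ h ∈ A, p h := fun A => Finset.sum_nonneg fun _ _ => hp _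
  have := fun A A' : Finset H => pairSum_mono he (Finset.inter_subset_inter_left (s := A) hS)
    (Finset.inter_subset_inter_left (s := A') hS)
  exact add_le_add (add_le_add (mul_le_mul_of_nonneg_left (this _ _) (hm _))
    (mul_le_mul_of_nonneg_left (this _ _) (hm _)))
    (mul_le_mul_of_nonneg_left (this _ _) (mul_nonneg zero_le_two (hm _)))

/-- The arithmetic for one within-half term of `splitGain_eq`: `α`, `β` are the masses of the two
halves, `a` the sampled mass of the first half and `u` its edge weight, with primes for the subset.
The hypothesis `h` is the density bound, and `hζ` is coverage, which can lose mass in the first half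
only at the expense of `a`. -/
theorem mul_le_mul_of_ratio_bounds {ζ α α' β β' a a' u u' : ℝ} (hβ' : 0 ≤ β')
    (hββ : β' ≤ β) (hu' : 0 ≤ u') (huu : u' ≤ u) (haα : a' ≤ α') (ha' : 0 ≤ a')
    (hζ : ζ * (α + β) ≤ a + β) (h : u' * a ≤ u * a') :
    ζ * (α + β) * (β' * u') ≤ (α' + β') * (β * u) := by
  have h1 : ζ * (α + β) * (β' * u') ≤ (a + β) * (β' * u') :=
    mul_le_mul_of_nonneg_right hζ (mul_nonneg hβ' hu')
  have h2 : β' * (u' * (a + β)) ≤ β' * (u * (a' + β)) := by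
    refine mul_le_mul_of_nonneg_left ?_ hβ'
    have := mul_le_mul_of_nonneg_right huu (hβ'.trans hββ)
    linarith
  have h3 : u * (β' * a') ≤ u * (β * α') :=
    mul_le_mul_of_nonneg_left (mul_le_mul hββ haα ha' (hβ'.trans hββ)) (hu'.trans huu)
  linarith

/-- Approximate adaptive submodularity: if `S` carries a `1 - η` fraction of the mass of `A`, then
the normalized gain on a subset of `A` is at most `1 / (1 - η)` times the one on `A`. -/
theorem splitGain_subset [DecidableEq H] {e : H → H → ℝ} {p : H → ℝ} (hp : ∀ h, 0 ≤ p h)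
    (he : ∀ h h', 0 ≤ e h h') (hsymm : ∀ h h', e h h' = e h' h)
    (hkey : ∀ j h h', p j * e h h' ≤ p h' * e j h + p h * e j h')
    {η : ℝ} (hη : 0 ≤ η) {S A B : Finset H} (hBA : B ⊆ A)
    (hcov : (1 - η) * ∑ h ∈ A, p h ≤ ∑ h ∈ A ∩ S, p h) (q : H → Bool) :
    (1 - η) * (∑ h ∈ A, p h) * splitGain e p S B q ≤ (∑ h ∈ B, p h) * splitGain e p S A q := by
  rw [splitGain_eq hsymm, splitGain_eq hsymm]
  have hm : ∀ A : Finset H, 0 ≤ ∑ h ∈ A, p h := fun A => Finset.sum_nonneg fun _ _ => hp _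
  have hmm : ∀ {A A' : Finset H}, A ⊆ A' → ∑ h ∈ A, p h ≤ ∑ h ∈ A', p h := fun h =>
    Finset.sum_le_sum_of_subset_of_nonneg h fun _ _ _ => hp _
  have hsub : ∀ b, B.filter (q · = b) ⊆ A.filter (q · = b) := fun b =>
    Finset.filter_subset_filter _ hBA
  have hsubS : ∀ b, B.filter (q · = b) ∩ S ⊆ A.filter (q · = b) ∩ S := fun b =>
    Finset.inter_subset_inter_right (hsub b)
  have hS : ∀ b, (A ∩ S).filter (q · = b) = A.filter (q · = b) ∩ S := fun b => by
    ext h; simp only [Finset.mem_filter, Finset.mem_inter]; tauto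
  have hA := sum_filter_bool p A q
  have hB := sum_filter_bool p B q
  have hAS := sum_filter_bool p (A ∩ S) q
  rw [hS, hS] at hAS
  have hl := fun b : Bool => hmm (Finset.inter_subset_left (s₁ := A.filter (q · = b)) (s₂ := S))
  have h1 := mul_le_mul_of_ratio_bounds (ζ := 1 - η)
    (α := ∑ h ∈ A.filter (q · = true), p h) (a := ∑ h ∈ A.filter (q · = true) ∩ S, p h)
    (hm (B.filter (q · = false))) (hmm (hsub false))
    (pairSum_nonneg he _ _) (pairSum_mono he (hsubS true) (hsubS true))
    (hmm (Finset.inter_subset_left (s₁ := B.filter (q · = true)) (s₂ := S))) (hm _)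
    (by have := hl false; rw [← hA]; linarith)
    (pairSum_mul_mass_le hp he hsymm hkey (hsubS true))
  have h2 := mul_le_mul_of_ratio_bounds (ζ := 1 - η)
    (α := ∑ h ∈ A.filter (q · = false), p h) (a := ∑ h ∈ A.filter (q · = false) ∩ S, p h)
    (hm (B.filter (q · = true))) (hmm (hsub true))
    (pairSum_nonneg he _ _) (pairSum_mono he (hsubS false) (hsubS false))
    (hmm (Finset.inter_subset_left (s₁ := B.filter (q · = false)) (s₂ := S))) (hm _)
    (by have := hl true; rw [add_comm, ← hA]; linarith)
    (pairSum_mul_mass_le hp he hsymm hkey (hsubS false))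
  -- The crossing pairs need only monotonicity; the factor `1 - η` is given away.
  have h3 : (1 - η) * ((∑ h ∈ A, p h) * (2 * (∑ h ∈ B, p h) *
      pairSum e (B.filter (q · = true) ∩ S) (B.filter (q · = false) ∩ S))) ≤
      (∑ h ∈ A, p h) * (2 * (∑ h ∈ B, p h) *
      pairSum e (A.filter (q · = true) ∩ S) (A.filter (q · = false) ∩ S)) := by
    have h4 := mul_le_mul_of_nonneg_left (mul_le_mul_of_nonneg_left
      (pairSum_mono he (hsubS true) (hsubS false)) (mul_nonneg zero_le_two (hm B))) (hm A)
    have h5 := mul_nonneg (hm A) (mul_nonneg (mul_nonneg zero_le_two (hm B))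
      (pairSum_nonneg he (B.filter (q · = true) ∩ S) (B.filter (q · = false) ∩ S)))
    nlinarith
  rw [← hA, ← hB] at h1
  rw [add_comm (∑ h ∈ A.filter (q · = false), p h),
    add_comm (∑ h ∈ B.filter (q · = false), p h), ← hA, ← hB] at h2
  linarith

end PairSums

/-! ### Observation vectors and consistency. -/

theorem Obs.consistent_empty {T : Type*} (h : Hyp T) : (Obs.empty T).Consistent h :=
  fun _ _ hx => by simp [Obs.empty] at hx

theorem Obs.consistent_extend_iff {T : Type*} [DecidableEq T] {x : Obs T} {t : T}
    (ht : x t = none) (b : Bool) (h : Hyp T) :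
    (x.extend t b).Consistent h ↔ x.Consistent h ∧ h t = b := by
  constructor
  · refine fun hc => ⟨fun s c hs => ?_, hc t b (by simp [Obs.extend])⟩
    have hst : s ≠ t := by rintro rfl; simp [ht] at hs
    exact hc s c (by simpa [Obs.extend, hst] using hs)
  · rintro ⟨hc, hb⟩ s c hs
    by_cases hst : s = t
    · subst hst
      simp only [Obs.extend, Function.update_self, Option.some.injEq] at hs
      rw [hb, hs]
    · exact hc s c (by simpa [Obs.extend, hst] using hs)

/-! ### The graph of decision regions, and the EC² objective as a pair sum. -/

namespace VoIModel

noncomputable section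

open scoped Classical

variable {Y T D : Type*} [Fintype Y] [Fintype T] [DecidableEq T] [Fintype D]

theorem condProb_nonneg (M : VoIModel Y T D) (h : Hyp T) (y : Y) : 0 ≤ M.condProb h y :=
  Finset.prod_nonneg fun t _ => by
    split_ifs
    · exact M.θ_nonneg t y
    · linarith [M.θ_le_one t y]

theorem sum_condProb (M : VoIModel Y T D) (y : Y) : ∑ h : Hyp T, M.condProb h y = 1 := by
  have := Finset.prod_univ_sum (fun _ : T => (Finset.univ : Finset Bool))
    (fun t b => if b = true then M.θ t y else 1 - M.θ t y)
  rw [Fintype.piFinset_univ] at this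
  unfold condProb
  rw [← this]
  exact Finset.prod_eq_one fun t _ => by simp

theorem prob_nonneg (M : VoIModel Y T D) (h : Hyp T) : 0 ≤ M.prob h :=
  Finset.sum_nonneg fun y _ => mul_nonneg (M.prior_nonneg y) (M.condProb_nonneg h y)

theorem sum_prob (M : VoIModel Y T D) : ∑ h, M.prob h = 1 := by
  unfold prob
  rw [Finset.sum_comm]
  simp_rw [← Finset.mul_sum, sum_condProb, mul_one]
  exact M.prior_sum

theorem exists_mem_region [Nonempty D] (M : VoIModel Y T D) {h : Hyp T} (hh : 0 < M.prob h) :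
    ∃ d, h ∈ M.region d := by
  obtain ⟨d, hd⟩ := exists_eq_ciSup_of_finite (f := fun d => M.expUtil d h)
  exact ⟨d, hh, hd⟩

theorem IsEdge.symm {M : VoIModel Y T D} {h h' : Hyp T} (hE : M.IsEdge h h') : M.IsEdge h' h := by
  obtain ⟨d, d', hne, h1, h2⟩ := hE
  exact ⟨d', d, hne.symm, h2, h1⟩

/-- Every possible hypothesis is joined to an endpoint of every edge. -/
theorem IsEdge.left_or_right {M : VoIModel Y T D} {h h' : Hyp T} (hE : M.IsEdge h h')
    {j : Hyp T} (hj : 0 < M.prob j) : M.IsEdge j h ∨ M.IsEdge j h' := by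
  obtain ⟨d, d', hne, h1, h2⟩ := hE
  have : Nonempty D := ⟨d⟩
  obtain ⟨c, hc⟩ := M.exists_mem_region hj
  by_cases hcd : c = d
  · exact Or.inr ⟨c, d', hcd ▸ hne, hc, h2⟩
  · exact Or.inl ⟨c, d, hcd, hc, h1⟩

/-- The weight of `{h, h'}` if it is an edge, and `0` otherwise. -/
def edgeWeight (M : VoIModel Y T D) (h h' : Hyp T) : ℝ :=
  if M.IsEdge h h' then M.prob h * M.prob h' else 0

theorem edgeWeight_nonneg (M : VoIModel Y T D) (h h' : Hyp T) : 0 ≤ M.edgeWeight h h' := by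
  unfold edgeWeight
  split_ifs
  exacts [mul_nonneg (M.prob_nonneg h) (M.prob_nonneg h'), le_rfl]

theorem edgeWeight_le (M : VoIModel Y T D) (h h' : Hyp T) :
    M.edgeWeight h h' ≤ M.prob h * M.prob h' := by
  unfold edgeWeight
  split_ifs
  exacts [le_rfl, mul_nonneg (M.prob_nonneg h) (M.prob_nonneg h')]

theorem edgeWeight_comm (M : VoIModel Y T D) (h h' : Hyp T) :
    M.edgeWeight h h' = M.edgeWeight h' h := by
  unfold edgeWeight
  rw [mul_comm, show M.IsEdge h h' ↔ M.IsEdge h' h from ⟨IsEdge.symm, IsEdge.symm⟩]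

/-- The abstract hypothesis `hkey` for the EC² graph: for possible `j`, whichever of the edges from
`j` to `h` or `h'` exists contributes the full triple product of probabilities. -/
theorem prob_mul_edgeWeight_le (M : VoIModel Y T D) (j h h' : Hyp T) :
    M.prob j * M.edgeWeight h h' ≤ M.prob h' * M.edgeWeight j h + M.prob h * M.edgeWeight j h' := by
  have n1 := mul_nonneg (M.prob_nonneg h') (M.edgeWeight_nonneg j h)
  have n2 := mul_nonneg (M.prob_nonneg h) (M.edgeWeight_nonneg j h')
  rcases (M.prob_nonneg j).eq_or_lt with hj | hj
  · rw [← hj, zero_mul]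
    exact add_nonneg n1 n2
  · by_cases hE : M.IsEdge h h'
    · have e0 : M.edgeWeight h h' = M.prob h * M.prob h' := if_pos hE
      rcases hE.left_or_right hj with hL | hR
      · have e1 : M.edgeWeight j h = M.prob j * M.prob h := if_pos hL
        rw [e0]; rw [e1] at n1 ⊢; linarith
      · have e1 : M.edgeWeight j h' = M.prob j * M.prob h' := if_pos hR
        rw [e0]; rw [e1] at n2 ⊢; linarith
    · have e0 : M.edgeWeight h h' = 0 := if_neg hE
      rw [e0, mul_zero]
      exact add_nonneg n1 n2

/-- The hypotheses that agree with the observations `x`. -/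
def consistentSet (x : Obs T) : Finset (Hyp T) := Finset.univ.filter x.Consistent

theorem consistentSet_empty : consistentSet (Obs.empty T) = Finset.univ :=
  Finset.filter_true_of_mem fun h _ => Obs.consistent_empty h

theorem consistentSet_extend {x : Obs T} {t : T} (ht : x t = none) (b : Bool) :
    consistentSet (x.extend t b) = (consistentSet x).filter (· t = b) := by
  ext h
  simp [consistentSet, Obs.consistent_extend_iff ht]

theorem jointProb_eq (M : VoIModel Y T D) (S : Finset (Hyp T)) (x : Obs T) :
    M.jointProb S x = ∑ h ∈ consistentSet x ∩ S, M.prob h := by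
  unfold jointProb
  rw [← Finset.sum_filter]
  congr 1
  ext h
  simp [consistentSet, and_comm]

theorem obsProb_eq (M : VoIModel Y T D) (x : Obs T) :
    M.obsProb x = ∑ h ∈ consistentSet x, M.prob h := by
  unfold obsProb
  rw [jointProb_eq, Finset.inter_univ]

theorem obsProb_empty (M : VoIModel Y T D) : M.obsProb (Obs.empty T) = 1 := by
  rw [obsProb_eq, consistentSet_empty, sum_prob]

theorem obsProb_nonneg (M : VoIModel Y T D) (x : Obs T) : 0 ≤ M.obsProb x := by
  rw [obsProb_eq]
  exact Finset.sum_nonneg fun h _ => M.prob_nonneg h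

theorem obsProb_le_one (M : VoIModel Y T D) (x : Obs T) : M.obsProb x ≤ 1 := by
  rw [obsProb_eq, ← M.sum_prob]
  exact Finset.sum_le_sum_of_subset_of_nonneg (Finset.subset_univ _) fun h _ _ => M.prob_nonneg h

theorem obsProb_extend_add (M : VoIModel Y T D) {x : Obs T} {t : T} (ht : x t = none) :
    M.obsProb (x.extend t true) + M.obsProb (x.extend t false) = M.obsProb x := by
  rw [obsProb_eq, obsProb_eq, obsProb_eq, consistentSet_extend ht, consistentSet_extend ht,
    ← sum_filter_bool]

theorem cutWeight_eq (M : VoIModel Y T D) (S : Finset (Hyp T)) (x : Obs T) :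
    M.cutWeight S x = 1 / 2 * (pairSum M.edgeWeight S S -
      pairSum M.edgeWeight (consistentSet x ∩ S) (consistentSet x ∩ S)) := by
  have hS : consistentSet x ∩ S = S.filter x.Consistent := by
    ext h; simp [consistentSet, and_comm]
  unfold cutWeight pairSum
  rw [hS, Finset.sum_filter, ← Finset.sum_sub_distrib]
  congr 1
  refine Finset.sum_congr rfl fun h _ => ?_
  by_cases hc : x.Consistent h
  · rw [if_pos hc, Finset.sum_filter, ← Finset.sum_sub_distrib]
    refine Finset.sum_congr rfl fun h' _ => ?_
    unfold edgeWeight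
    by_cases hE : M.IsEdge h h' <;> by_cases hc' : x.Consistent h' <;> simp [hE, hc, hc']
  · rw [if_neg hc, sub_zero]
    refine Finset.sum_congr rfl fun h' _ => ?_
    unfold edgeWeight
    simp [hc]

theorem ec2_eq (M : VoIModel Y T D) (x : Obs T) :
    M.ec2 x = 1 / 2 * (pairSum M.edgeWeight Finset.univ Finset.univ -
      pairSum M.edgeWeight (consistentSet x) (consistentSet x)) := by
  unfold ec2
  rw [cutWeight_eq, Finset.inter_univ]

theorem ec2_empty (M : VoIModel Y T D) : M.ec2 (Obs.empty T) = 0 := by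
  rw [ec2_eq, consistentSet_empty, sub_self, mul_zero]

theorem ec2_nonneg (M : VoIModel Y T D) (x : Obs T) : 0 ≤ M.ec2 x := by
  rw [ec2_eq]
  have := pairSum_mono M.edgeWeight_nonneg (Finset.subset_univ (consistentSet x))
    (Finset.subset_univ (consistentSet x))
  linarith

/-- The total weight of all edges. -/
def totalWeight (M : VoIModel Y T D) : ℝ := 1 / 2 * pairSum M.edgeWeight Finset.univ Finset.univ

theorem totalWeight_le (M : VoIModel Y T D) : M.totalWeight ≤ 1 / 2 := by
  have := pairSum_le_mul M.edgeWeight_le Finset.univ Finset.univ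
  rw [sum_prob] at this
  unfold totalWeight
  linarith

theorem ec2_le_of_subset (M : VoIModel Y T D) {x : Obs T} {B : Finset (Hyp T)}
    (hB : B ⊆ consistentSet x) :
    M.ec2 x ≤ M.totalWeight - 1 / 2 * pairSum M.edgeWeight B B := by
  rw [ec2_eq]
  have := pairSum_mono M.edgeWeight_nonneg hB hB
  unfold totalWeight
  linarith

theorem ec2_le_totalWeight (M : VoIModel Y T D) (x : Obs T) : M.ec2 x ≤ M.totalWeight := by
  have := M.ec2_le_of_subset (Finset.empty_subset (consistentSet x))
  simpa [pairSum] using this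

theorem obsProb_mul_gain (M : VoIModel Y T D) (S : Finset (Hyp T)) {x : Obs T} {t : T}
    (ht : x t = none) :
    M.obsProb x * M.gain S x t =
      1 / 2 * splitGain M.edgeWeight M.prob S (consistentSet x) (· t) := by
  have h1 : M.obsProb x * M.gain S x t = ∑ b : Bool, M.obsProb (x.extend t b) *
      (M.cutWeight S (x.extend t b) - M.cutWeight S x) := by
    have hadd := M.obsProb_extend_add ht
    have hn := fun b => M.obsProb_nonneg (x.extend t b)
    unfold gain
    rw [Finset.mul_sum]
    refine Finset.sum_congr rfl fun b _ => ?_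
    -- If `x` has probability zero, so do both extensions, and the value given to the division by
    -- zero does not matter.
    by_cases hx : M.obsProb x = 0
    · have : M.obsProb (x.extend t b) = 0 := by
        cases b <;> linarith [hn true, hn false]
      rw [hx, this]; ring
    · field_simp
  have hadd := M.obsProb_extend_add ht
  rw [h1]
  unfold splitGain
  simp only [cutWeight_eq, Fintype.sum_bool, obsProb_eq,
    consistentSet_extend ht] at hadd ⊢
  rw [← hadd]
  ring

theorem gain_nonneg (M : VoIModel Y T D) (S : Finset (Hyp T)) {x : Obs T} {t : T}
    (ht : x t = none) : 0 ≤ M.gain S x t := by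
  rcases (M.obsProb_nonneg x).eq_or_lt with hx | hx
  · unfold gain
    simp [← hx]
  · have h1 := M.obsProb_mul_gain S ht
    have h2 := splitGain_nonneg M.prob_nonneg M.edgeWeight_nonneg M.edgeWeight_comm S
      (consistentSet x) (· t)
    exact nonneg_of_mul_nonneg_right (by rw [h1]; linarith) hx

/-- The full objective gains at least as much as the sampled one, because outcome probabilities are
exact in both and `splitGain` is monotone in `S`. Sampling thus costs nothing in the value realized
by the greedy step. -/
theorem obsProb_mul_ec2_add_gain (M : VoIModel Y T D) (S : Finset (Hyp T)) {x : Obs T} {t : T}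
    (ht : x t = none) :
    M.obsProb x * (M.ec2 x + M.gain S x t) ≤
      ∑ b : Bool, M.obsProb (x.extend t b) * M.ec2 (x.extend t b) := by
  have h1 := M.obsProb_mul_gain S ht
  have h2 := splitGain_mono_left M.prob_nonneg M.edgeWeight_nonneg M.edgeWeight_comm
    (Finset.subset_univ S) (consistentSet x) (· t)
  have h3 : ∑ b : Bool, M.obsProb (x.extend t b) * M.ec2 (x.extend t b) = M.obsProb x * M.ec2 x +
      1 / 2 * splitGain M.edgeWeight M.prob Finset.univ (consistentSet x) (· t) := by
    unfold splitGain
    have hadd := M.obsProb_extend_add ht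
    simp only [ec2_eq, Fintype.sum_bool, obsProb_eq, Finset.inter_univ,
      consistentSet_extend ht] at hadd ⊢
    rw [← hadd]
    ring
  rw [h3, mul_add, h1]
  linarith

theorem Covers.nonneg {M : VoIModel Y T D} {η : ℝ} {S : Obs T → Finset (Hyp T)}
    (hS : M.Covers η S) : 0 ≤ η := by
  have h1 := hS (Obs.empty T)
  have h2 : M.jointProb (S (Obs.empty T)) (Obs.empty T) ≤ 1 := by
    rw [jointProb_eq, ← M.sum_prob]
    exact Finset.sum_le_sum_of_subset_of_nonneg (Finset.subset_univ _) fun h _ _ => M.prob_nonneg h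
  rw [obsProb_empty] at h1
  linarith

/-- Pairs not inside `S` have an endpoint in `A \ S`, whose mass is at most `η` times that of `A`;
each of the two positions of this endpoint costs one `η`. -/
theorem pairSum_le_inter_add (M : VoIModel Y T D) {η : ℝ} {S A : Finset (Hyp T)}
    (hcov : (1 - η) * ∑ h ∈ A, M.prob h ≤ ∑ h ∈ A ∩ S, M.prob h) :
    pairSum M.edgeWeight A A ≤
      pairSum M.edgeWeight (A ∩ S) (A ∩ S) + 2 * η * (∑ h ∈ A, M.prob h) ^ 2 := by
  have hm : 0 ≤ ∑ h ∈ A, M.prob h := Finset.sum_nonneg fun h _ => M.prob_nonneg h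
  have h1 := pairSum_filter_left M.edgeWeight A A (· ∈ S)
  have h2 := pairSum_filter_right M.edgeWeight (A.filter (· ∈ S)) A (· ∈ S)
  have h3 := Finset.sum_filter_add_sum_filter_not A (· ∈ S) M.prob
  rw [Finset.filter_mem_eq_inter] at h1 h2 h3
  have h4 := pairSum_le_mul M.edgeWeight_le (A.filter fun h => ¬ h ∈ S) A
  have h5 := (pairSum_mono M.edgeWeight_nonneg (Finset.inter_subset_left (s₁ := A) (s₂ := S))
    (subset_refl (A.filter fun h => ¬ h ∈ S))).trans (pairSum_le_mul M.edgeWeight_le _ _)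
  have h6 : ∑ h ∈ A.filter (fun h => ¬ h ∈ S), M.prob h ≤ η * ∑ h ∈ A, M.prob h := by linarith
  have h7 := mul_le_mul_of_nonneg_right h6 hm
  linarith

end

end VoIModel

/-! ### Policies: existence of an optimum and bounds along a run. -/

instance Policy.instFinite (T : Type*) [Finite T] : Finite (Policy T) :=
  Finite.of_injective Policy.next fun π π' h => by
    cases π; cases π'; cases h; rfl

instance Policy.instNonempty (T : Type*) : Nonempty (Policy T) :=
  ⟨⟨fun _ => none, fun _ _ h => nomatch h⟩⟩

namespace VoIModel

noncomputable section

open scoped Classical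

variable {Y T D : Type*} [Fintype Y] [Fintype T] [DecidableEq T] [Fintype D]

theorem exists_isOptimal (M : VoIModel Y T D) (b : ℝ) : ∃ π : Policy T, M.IsOptimal b π :=
  Finite.exists_max fun π : Policy T => M.favg π b

theorem runUtil_mem_Icc (M : VoIModel Y T D) (π : Policy T) (h : Hyp T) (n : ℕ) {r : ℝ}
    (hr : 0 ≤ r) (x : Obs T) : M.runUtil π h n r x ∈ Set.Icc 0 M.totalWeight := by
  have hec : ∀ x, M.ec2 x ∈ Set.Icc 0 M.totalWeight := fun x =>
    ⟨M.ec2_nonneg x, M.ec2_le_totalWeight x⟩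
  induction n generalizing r x with
  | zero => exact hec x
  | succ n ih =>
    unfold runUtil
    split
    · exact hec x
    · rename_i t _
      split_ifs with hc
      · exact ih (sub_nonneg.2 hc) _
      · push Not at hc
        have hq1 : r / M.cost t ≤ 1 := div_le_one_of_le₀ hc.le (M.cost_nonneg t)
        exact convex_Icc _ _ (hec x) (hec _) (sub_nonneg.2 hq1)
          (div_nonneg hr (M.cost_nonneg t)) (sub_add_cancel _ _)

theorem favg_mem_Icc (M : VoIModel Y T D) (π : Policy T) {b : ℝ} (hb : 0 ≤ b) :
    M.favg π b ∈ Set.Icc 0 (1 / 2) := by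
  refine ⟨Finset.sum_nonneg fun h _ =>
    mul_nonneg (M.prob_nonneg h) (M.runUtil_mem_Icc π h _ hb _).1, ?_⟩
  refine (Finset.sum_le_sum fun h _ => mul_le_mul_of_nonneg_left
    ((M.runUtil_mem_Icc π h _ hb _).2.trans M.totalWeight_le) (M.prob_nonneg h)).trans ?_
  rw [← Finset.sum_mul, sum_prob, one_mul]

/-- If on all subsets of `A` the expected reduction of the edges inside `S` is at most `ρ` per unit
cost, then a policy with budget `r` reduces them by at most `r * ρ`. -/
theorem sum_runUtil_le (M : VoIModel Y T D) (π : Policy T) {S A : Finset (Hyp T)} {ρ : ℝ}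
    (hρ : 0 ≤ ρ) (hA : ∀ t, ∀ B ⊆ A, 1 / 2 * splitGain M.edgeWeight M.prob S B (· t) ≤
      (∑ h ∈ B, M.prob h) * (M.cost t * ρ)) (n : ℕ) {r : ℝ} (hr : 0 ≤ r) (y : Obs T)
    {B : Finset (Hyp T)} (hB : B = A ∩ consistentSet y) :
    ∑ h ∈ B, M.prob h * M.runUtil π h n r y ≤
      (∑ h ∈ B, M.prob h) *
        (M.totalWeight - 1 / 2 * pairSum M.edgeWeight (B ∩ S) (B ∩ S) + r * ρ) := by
  have hm : ∀ B : Finset (Hyp T), 0 ≤ ∑ h ∈ B, M.prob h := fun B =>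
    Finset.sum_nonneg fun h _ => M.prob_nonneg h
  -- The potential is the weight of all edges except those inside `B ∩ S`. It dominates `ec2 y`
  -- because every hypothesis of `B` is consistent with `y`.
  have hec : ∀ (y : Obs T) (B : Finset (Hyp T)), B = A ∩ consistentSet y →
      M.ec2 y ≤ M.totalWeight - 1 / 2 * pairSum M.edgeWeight (B ∩ S) (B ∩ S) := fun y B hB =>
    M.ec2_le_of_subset (Finset.inter_subset_left.trans (hB ▸ Finset.inter_subset_right))
  have hhalt : ∀ (y : Obs T) (B : Finset (Hyp T)) (r : ℝ), 0 ≤ r → B = A ∩ consistentSet y →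
      ∑ h ∈ B, M.prob h * M.ec2 y ≤ (∑ h ∈ B, M.prob h) *
        (M.totalWeight - 1 / 2 * pairSum M.edgeWeight (B ∩ S) (B ∩ S) + r * ρ) := by
    intro y B r hr hB
    rw [← Finset.sum_mul]
    exact mul_le_mul_of_nonneg_left
      ((hec y B hB).trans (le_add_of_nonneg_right (mul_nonneg hr hρ))) (hm B)
  induction n generalizing r y B with
  | zero => exact hhalt y B r hr hB
  | succ n ih =>
    unfold runUtil
    split
    · exact hhalt y B r hr hB
    · rename_i t hnext
      have ht := π.fresh y t hnext
      have hBsub : B ⊆ A := hB ▸ Finset.inter_subset_left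
      have hBb : ∀ b, B.filter (· t = b) = A ∩ consistentSet (y.extend t b) := by
        intro b
        rw [consistentSet_extend ht, hB]
        ext h
        simp only [Finset.mem_filter, Finset.mem_inter]
        tauto
      have hgain := hA t B hBsub
      unfold splitGain at hgain
      rw [Fintype.sum_bool] at hgain
      have hmB := sum_filter_bool M.prob B (· t)
      have hconst : ∀ b : Bool, ∀ F : Bool → Hyp T → ℝ,
          ∑ h ∈ B.filter (· t = b), F (h t) h = ∑ h ∈ B.filter (· t = b), F b h := fun b F =>
        Finset.sum_congr rfl fun h hh => by rw [(Finset.mem_filter.1 hh).2]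
      split_ifs with hc
      · have ih' := fun b => ih (sub_nonneg.2 hc) (y.extend t b) (hBb b)
        rw [sum_filter_bool _ B (· t),
          hconst true fun b h => M.prob h * M.runUtil π h n (r - M.cost t) (y.extend t b),
          hconst false fun b h => M.prob h * M.runUtil π h n (r - M.cost t) (y.extend t b)]
        refine (add_le_add (ih' true) (ih' false)).trans ?_
        rw [hmB] at hgain ⊢
        linarith
      · push Not at hc
        have hc0 : 0 < M.cost t := hr.trans_lt hc
        have hq1 : r / M.cost t ≤ 1 := div_le_one_of_le₀ hc.le hc0.le
        have hq0 : 0 ≤ r / M.cost t := div_nonneg hr hc0.le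
        have hqc : r / M.cost t * M.cost t = r := div_mul_cancel₀ _ hc0.ne'
        generalize r / M.cost t = q at *
        -- Budget `0` here: the whole term `r * ρ` is kept to pay for the fraction `q` of the last
        -- test, whose expected cost is `q * M.cost t = r`.
        have h0 := hhalt y B 0 le_rfl hB
        have h1 := fun b => hhalt (y.extend t b) _ 0 le_rfl (hBb b)
        have hsum : ∑ h ∈ B, M.prob h * ((1 - q) * M.ec2 y + q * M.ec2 (y.extend t (h t))) =
            (1 - q) * ∑ h ∈ B, M.prob h * M.ec2 y +
              q * (∑ h ∈ B.filter (· t = true), M.prob h * M.ec2 (y.extend t true) +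
                ∑ h ∈ B.filter (· t = false), M.prob h * M.ec2 (y.extend t false)) := by
          rw [← hconst true fun b h => M.prob h * M.ec2 (y.extend t b),
            ← hconst false fun b h => M.prob h * M.ec2 (y.extend t b), ← sum_filter_bool,
            Finset.mul_sum, Finset.mul_sum, ← Finset.sum_add_distrib]
          exact Finset.sum_congr rfl fun h _ => by ring
        rw [hsum]
        refine (add_le_add (mul_le_mul_of_nonneg_left h0 (sub_nonneg.2 hq1))
          (mul_le_mul_of_nonneg_left (add_le_add (h1 true) (h1 false)) hq0)).trans ?_
        have h2 := mul_le_mul_of_nonneg_left hgain hq0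
        rw [show r * ρ = q * (M.cost t * ρ) by rw [← mul_assoc, hqc]]
        rw [hmB] at h2 ⊢
        linarith

/-- If no test has a gain of more than `ρ` per unit cost on a set that carries a `1 - η` fraction of
the mass consistent with `x`, then no policy with budget `k` gains more than `k * ρ + 2 * η` over
`x`. -/
theorem sum_consistentSet_runUtil_le (M : VoIModel Y T D) (π : Policy T) {η : ℝ} (hη : 0 ≤ η)
    (hη1 : η < 1) {S : Finset (Hyp T)} {x : Obs T}
    (hcov : (1 - η) * M.obsProb x ≤ M.jointProb S x) {ρ : ℝ} (hρ : 0 ≤ ρ)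
    (hgain : ∀ t, x t = none → M.gain S x t ≤ ρ * M.cost t) (n : ℕ) {k : ℝ} (hk : 0 ≤ k) :
    ∑ h ∈ consistentSet x, M.prob h * M.runUtil π h n k (Obs.empty T) ≤
      M.obsProb x * (M.ec2 x + k * ρ + 2 * η) := by
  have h1η : 0 < 1 - η := sub_pos.2 hη1
  rw [obsProb_eq, jointProb_eq] at hcov
  have hmx := M.obsProb_nonneg x
  have hmx1 := M.obsProb_le_one x
  set A := consistentSet x with hAdef
  have hsplit : ∀ t, 1 / 2 * splitGain M.edgeWeight M.prob S A (· t) ≤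
      M.obsProb x * (ρ * M.cost t) := by
    intro t
    rcases hxt : x t with _ | b
    · rw [← M.obsProb_mul_gain S hxt]
      exact mul_le_mul_of_nonneg_left (hgain t hxt) hmx
    -- The competing policy starts afresh and may repeat a test recorded in `x`; its outcome is
    -- constant on `A`, so nothing is gained.
    · have hb : A.filter (· t = b) = A := Finset.filter_true_of_mem fun h hh =>
        (Finset.mem_filter.1 hh).2 t b hxt
      have hb' : A.filter (· t = !b) = ∅ := Finset.filter_false_of_mem fun h hh => by
        rw [(Finset.mem_filter.1 hh).2 t b hxt]; cases b <;> simp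
      have : splitGain M.edgeWeight M.prob S A (· t) = 0 := by
        unfold splitGain
        rw [Fintype.sum_bool]
        cases b <;> simp only [Bool.not_true, Bool.not_false] at hb' <;> rw [hb, hb'] <;>
          simp
      rw [this, mul_zero]
      exact mul_nonneg hmx (mul_nonneg hρ (M.cost_nonneg t))
  have hm : ∀ B : Finset (Hyp T), 0 ≤ ∑ h ∈ B, M.prob h := fun B =>
    Finset.sum_nonneg fun h _ => M.prob_nonneg h
  have hsub : ∀ t, ∀ B ⊆ A, 1 / 2 * splitGain M.edgeWeight M.prob S B (· t) ≤
      (∑ h ∈ B, M.prob h) * (M.cost t * (ρ / (1 - η))) := by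
    intro t B hB
    have h1 := splitGain_subset M.prob_nonneg M.edgeWeight_nonneg M.edgeWeight_comm
      M.prob_mul_edgeWeight_le hη hB hcov (· t)
    have h2 := mul_le_mul_of_nonneg_left (hsplit t) (hm B)
    rw [obsProb_eq] at h2
    rcases (hm A).eq_or_lt with hA0 | hA0
    · have hB0 : ∑ h ∈ B, M.prob h = 0 := le_antisymm
        ((Finset.sum_le_sum_of_subset_of_nonneg hB fun h _ _ => M.prob_nonneg h).trans hA0.symm.le)
        (hm B)
      have hz : ∀ C ⊆ B, ∑ h ∈ C, M.prob h = 0 := fun C hC => le_antisymm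
        ((Finset.sum_le_sum_of_subset_of_nonneg hC fun h _ _ => M.prob_nonneg h).trans hB0.le) (hm C)
      unfold splitGain
      rw [Fintype.sum_bool, hz _ (Finset.filter_subset _ _), hz _ (Finset.filter_subset _ _), hB0]
      simp
    · rw [← mul_le_mul_iff_right₀ (mul_pos h1η hA0)]
      have h3 : (1 - η) * (∑ h ∈ A, M.prob h) *
          ((∑ h ∈ B, M.prob h) * (M.cost t * (ρ / (1 - η)))) =
          (∑ h ∈ B, M.prob h) * ((∑ h ∈ A, M.prob h) * (ρ * M.cost t)) := by
        field_simp
      rw [h3]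
      linarith
  have hmain := M.sum_runUtil_le π (div_nonneg hρ h1η.le) hsub n hk (Obs.empty T)
    (by rw [consistentSet_empty, Finset.inter_univ] : A = _)
  -- The trivial bound is averaged with `hmain` with weights `η` and `1 - η`. This removes the
  -- denominator `1 - η` from the rate and leaves an additive error.
  have htriv : ∑ h ∈ A, M.prob h * M.runUtil π h n k (Obs.empty T) ≤
      (∑ h ∈ A, M.prob h) * M.totalWeight := by
    rw [Finset.sum_mul]
    exact Finset.sum_le_sum fun h _ =>
      mul_le_mul_of_nonneg_left (M.runUtil_mem_Icc π h n hk _).2 (M.prob_nonneg h)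
  have hin := M.pairSum_le_inter_add hcov
  have hec : M.ec2 x = M.totalWeight - 1 / 2 * pairSum M.edgeWeight A A := by
    rw [ec2_eq]; unfold totalWeight; ring
  have hle1 : pairSum M.edgeWeight (A ∩ S) (A ∩ S) ≤ 1 := by
    refine (pairSum_mono M.edgeWeight_nonneg (Finset.subset_univ _)
      (Finset.subset_univ _)).trans ?_
    have := M.totalWeight_le
    unfold totalWeight at this
    linarith
  rw [hec]
  rw [obsProb_eq] at hmx hmx1 ⊢
  set m := ∑ h ∈ A, M.prob h
  set Q := ∑ h ∈ A, M.prob h * M.runUtil π h n k (Obs.empty T)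
  set v := pairSum M.edgeWeight (A ∩ S) (A ∩ S)
  have h1 : (1 - η) * Q ≤ (1 - η) * (m * (M.totalWeight - 1 / 2 * v)) + m * (k * ρ) := by
    refine (mul_le_mul_of_nonneg_left hmain h1η.le).trans (le_of_eq ?_)
    field_simp
  have h2 := mul_le_mul_of_nonneg_left htriv hη
  have h3 : m * pairSum M.edgeWeight A A ≤ m * (v + 2 * η) := by
    refine mul_le_mul_of_nonneg_left (hin.trans ?_) hmx
    have : m ^ 2 ≤ 1 := pow_le_one₀ hmx hmx1
    nlinarith
  -- The averaging costs at most `η / 2` and passing from `v` to all edges inside `A` costs at most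
  -- `η`, relative to `m`; together they stay below `2 * η`.
  have h4 : η * (m * v) ≤ η * m := by
    have := mul_le_mul_of_nonneg_left hle1 (mul_nonneg hη hmx)
    linarith
  have h5 := mul_nonneg hη hmx
  linarith

/-- `Q` is the competitor's utility. The deficit, `Q` minus `ec2 x + δ` weighted over the consistent
hypotheses, is at most `k` times the best gain rate, which yields exponential decay in the budget
spent. The bound `hn` ensures that the counter `n` cannot run out while tests remain. -/
theorem sum_runUtil_greedy_ge (M : VoIModel Y T D) {S : Obs T → Finset (Hyp T)} {π : Policy T}
    (hg : M.IsGreedy S π) {k δ : ℝ} (hk : 0 < k) {Q : Hyp T → ℝ}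
    (hQ : ∀ x ρ, 0 ≤ ρ → (∀ t, x t = none → M.gain (S x) x t ≤ ρ * M.cost t) →
      ∑ h ∈ consistentSet x, M.prob h * Q h ≤ M.obsProb x * (M.ec2 x + k * ρ + δ))
    (n : ℕ) {r : ℝ} (hr : 0 ≤ r) (x : Obs T)
    (hn : (Finset.univ.filter fun t => x t = none).card ≤ n) :
    M.obsProb x * M.ec2 x + (1 - Real.exp (-(r / k))) *
        (∑ h ∈ consistentSet x, M.prob h * Q h - M.obsProb x * (M.ec2 x + δ)) ≤
      ∑ h ∈ consistentSet x, M.prob h * M.runUtil π h n r x := by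
  have hexp : ∀ {s : ℝ}, 0 ≤ s → Real.exp (-s) ≤ 1 := fun hs =>
    Real.exp_le_one_iff.2 (neg_nonpos.2 hs)
  have hhalt : ∀ x r, 0 ≤ r → (∀ t, x t = none → M.gain (S x) x t ≤ 0) →
      M.obsProb x * M.ec2 x + (1 - Real.exp (-(r / k))) *
        (∑ h ∈ consistentSet x, M.prob h * Q h - M.obsProb x * (M.ec2 x + δ)) ≤
      ∑ h ∈ consistentSet x, M.prob h * M.ec2 x := by
    intro x r hr hx
    -- When no gain is left, the rate `ρ = 0` shows that the deficit is not positive, so stopping is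
    -- harmless.
    have h1 := hQ x 0 le_rfl (by simpa using hx)
    rw [← Finset.sum_mul, ← obsProb_eq]
    have h2 := mul_nonneg (sub_nonneg.2 (hexp (div_nonneg hr hk.le)))
      (by linarith : 0 ≤ M.obsProb x * (M.ec2 x + δ) - ∑ h ∈ consistentSet x, M.prob h * Q h)
    linarith
  induction n generalizing r x with
  | zero =>
    refine hhalt x r hr fun t ht => ?_
    rw [Nat.le_zero, Finset.card_eq_zero, Finset.filter_eq_empty_iff] at hn
    exact absurd ht (hn (Finset.mem_univ t))
  | succ n ih =>
    unfold runUtil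
    split
    · rename_i hnext
      exact hhalt x r hr fun t ht => (hg x).2 hnext t ht
    · rename_i t hnext
      have ht := π.fresh x t hnext
      have hcard : ∀ b, (Finset.univ.filter fun s => x.extend t b s = none).card ≤ n := by
        intro b
        have : (Finset.univ.filter fun s => x.extend t b s = none) =
            (Finset.univ.filter fun s => x s = none).erase t := by
          ext s
          simp only [Finset.mem_filter, Finset.mem_erase, Finset.mem_univ, true_and]
          by_cases hs : s = t <;> simp [Obs.extend, hs]
        rw [this, Finset.card_erase_of_mem (by simpa using ht)]
        omega
      have hconst : ∀ b : Bool, ∀ F : Bool → Hyp T → ℝ,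
          ∑ h ∈ (consistentSet x).filter (· t = b), F (h t) h =
            ∑ h ∈ consistentSet (x.extend t b), F b h := fun b F => by
        rw [consistentSet_extend ht]
        exact Finset.sum_congr rfl fun h hh => by rw [(Finset.mem_filter.1 hh).2]
      have hgain0 := M.gain_nonneg (S x) ht
      have hstep := M.obsProb_mul_ec2_add_gain (S x) ht
      have hadd := M.obsProb_extend_add ht
      have hP := M.obsProb_nonneg x
      have hDrate : 0 < M.cost t → M.cost t *
          (∑ h ∈ consistentSet x, M.prob h * Q h - M.obsProb x * (M.ec2 x + δ)) ≤
          k * (M.obsProb x * M.gain (S x) x t) := by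
        intro hc
        have h1 := hQ x (M.gain (S x) x t / M.cost t) (div_nonneg hgain0 hc.le) fun s hs => by
          rw [div_mul_eq_mul_div, le_div_iff₀ hc]
          exact (hg x).1 t hnext s hs
        have h2 := mul_le_mul_of_nonneg_left h1 hc.le
        have h3 : M.cost t * (M.obsProb x *
            (M.ec2 x + k * (M.gain (S x) x t / M.cost t) + δ)) =
            M.cost t * (M.obsProb x * (M.ec2 x + δ)) + k * (M.obsProb x * M.gain (S x) x t) := by
          field_simp
          ring
        linarith
      rw [Fintype.sum_bool] at hstep
      rw [sum_filter_bool _ (consistentSet x) (· t)] at hDrate ⊢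
      rw [hconst true fun _ h => M.prob h * Q h, hconst false fun _ h => M.prob h * Q h]
        at hDrate ⊢
      set Q1 := ∑ h ∈ consistentSet (x.extend t true), M.prob h * Q h
      set Q0 := ∑ h ∈ consistentSet (x.extend t false), M.prob h * Q h
      set E := Q1 + Q0 - M.obsProb x * (M.ec2 x + δ) with hE
      set g := M.obsProb x * M.gain (S x) x t with hgdef
      have hg0 : 0 ≤ g := mul_nonneg hP hgain0
      split_ifs with hc
      · have ih' := fun b => ih (sub_nonneg.2 hc) (x.extend t b) (hcard b)
        rw [sum_filter_bool _ (consistentSet x) (· t),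
          hconst true fun b h => M.prob h * M.runUtil π h n (r - M.cost t) (x.extend t b),
          hconst false fun b h => M.prob h * M.runUtil π h n (r - M.cost t) (x.extend t b)]
        refine le_trans ?_ (add_le_add (ih' true) (ih' false))
        -- The deficit factor splits into the part for this test and the part for the remaining
        -- budget, to which the induction hypothesis applies.
        have hr' : Real.exp (-(r / k)) =
            Real.exp (-((r - M.cost t) / k)) * Real.exp (-(M.cost t / k)) := by
          rw [← Real.exp_add]; congr 1; ring
        have hge : (1 - Real.exp (-(M.cost t / k))) * E ≤ g := by
          -- A free test must close no part of the deficit, and a nonpositive deficit needs no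
          -- progress; otherwise `1 - exp (-s) ≤ s` turns the rate bound into the required fraction.
          rcases (M.cost_nonneg t).eq_or_lt with hc0 | hc0
          · rw [← hc0]; simpa using hg0
          · rcases le_total E 0 with hE0 | hE0
            · have := hexp (div_nonneg hc0.le hk.le)
              nlinarith
            · have h1 := Real.add_one_le_exp (-(M.cost t / k))
              have h2 : M.cost t / k * E ≤ g := by
                rw [div_mul_eq_mul_div, div_le_iff₀ hk]
                linarith [hDrate hc0]
              nlinarith
        have he0 := Real.exp_pos (-((r - M.cost t) / k))
        have he := mul_le_mul_of_nonneg_left hge he0.le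
        have hs := mul_le_mul_of_nonneg_left hstep he0.le
        rw [hr']
        generalize Real.exp (-((r - M.cost t) / k)) = a at *
        generalize Real.exp (-(M.cost t / k)) = a' at *
        have haddδ : M.obsProb (x.extend t true) * δ + M.obsProb (x.extend t false) * δ =
          M.obsProb x * δ := by rw [← hadd]; ring
        rw [hE] at he ⊢
        have key : a * (M.obsProb (x.extend t true) * δ) + a * (M.obsProb (x.extend t false) * δ) =
          a * (M.obsProb x * δ) := by rw [← haddδ]; ring
        linarith
      · push Not at hc
        have hc0 : 0 < M.cost t := hr.trans_lt hc
        have hq0 : 0 ≤ r / M.cost t := div_nonneg hr hc0.le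
        have hsum : ∑ h ∈ consistentSet x, M.prob h *
            ((1 - r / M.cost t) * M.ec2 x + r / M.cost t * M.ec2 (x.extend t (h t))) =
            (1 - r / M.cost t) * (M.obsProb x * M.ec2 x) +
              r / M.cost t * (M.obsProb (x.extend t true) * M.ec2 (x.extend t true) +
                M.obsProb (x.extend t false) * M.ec2 (x.extend t false)) := by
          rw [obsProb_eq, obsProb_eq, obsProb_eq, Finset.sum_mul, Finset.sum_mul, Finset.sum_mul,
            ← hconst true fun b h => M.prob h * M.ec2 (x.extend t b),
            ← hconst false fun b h => M.prob h * M.ec2 (x.extend t b), ← sum_filter_bool,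
            Finset.mul_sum, Finset.mul_sum, ← Finset.sum_add_distrib]
          exact Finset.sum_congr rfl fun h _ => by ring
        rw [hsum]
        -- The randomized last test keeps the proportion `r / M.cost t` of the gain, exactly what
        -- the rate bound demands for spending `r`.
        have hge : (1 - Real.exp (-(r / k))) * E ≤ r / M.cost t * g := by
          rcases le_total E 0 with hE0 | hE0
          · have := hexp (div_nonneg hr hk.le)
            have := mul_nonneg hq0 hg0
            nlinarith
          · have h1 := Real.add_one_le_exp (-(r / k))
            have h2 : r / k * E ≤ r / M.cost t * g := by
              have h3 := mul_le_mul_of_nonneg_left (hDrate hc0) hr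
              rw [div_mul_eq_mul_div, div_mul_eq_mul_div, div_le_div_iff₀ hk hc0]
              linarith
            nlinarith
        have hs := mul_le_mul_of_nonneg_left hstep hq0
        linarith

end

end VoIModel

/-! ### Assembly of the guarantee and comparison of the error terms. -/

theorem theorem3 {Y T D : Type*} [Fintype Y] [Fintype T] [DecidableEq T] [Fintype D]
    (M : VoIModel Y T D)
    (hdisj : ∀ d d', d ≠ d' → Disjoint (M.region d) (M.region d'))
    (η : ℝ) (S : Obs T → Finset (Hyp T)) (hS : M.Covers η S)
    (πg : Policy T) (hg : M.IsGreedy S πg)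
    (k l : ℕ) (hk : 0 < k) (hl : 0 < l) :
    (∃ πs : Policy T, M.IsOptimal k πs) ∧
    ∀ πs : Policy T, M.IsOptimal k πs →
      (1 - Real.exp (-((l : ℝ) / k))) * M.favg πs k
          - k * (2 * η * (1 - (1 - 1 / (k : ℝ)) ^ l)) ≤ M.favg πg l ∧
      (2 ≤ k →
        (1 - Real.exp (-((l : ℝ) / k))) * M.favg πs k
          - k * (2 * η * (1 - (1 / (k : ℝ)) ^ l)) ≤ M.favg πg l) := by
  have hη := hS.nonneg
  have hk' : (0 : ℝ) < k := Nat.cast_pos.2 hk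
  have hk1 : (1 : ℝ) ≤ k := Nat.one_le_cast.2 hk
  have hinv0 : 0 ≤ 1 / (k : ℝ) := by positivity
  have hinv1 : 1 / (k : ℝ) ≤ 1 := (div_le_one hk').2 hk1
  have hpow : (1 - 1 / (k : ℝ)) ^ l ≤ Real.exp (-((l : ℝ) / k)) := by
    have h1 := pow_le_pow_left₀ (sub_nonneg.2 hinv1) (Real.one_sub_le_exp_neg (1 / (k : ℝ))) l
    rwa [← Real.exp_nat_mul, show (l : ℝ) * -(1 / (k : ℝ)) = -((l : ℝ) / k) by ring] at h1
  have hexp1 : Real.exp (-((l : ℝ) / k)) ≤ 1 :=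
    Real.exp_le_one_iff.2 (neg_nonpos.2 (by positivity))
  refine ⟨M.exists_isOptimal k, fun πs _ => ?_⟩
  have hfirst : (1 - Real.exp (-((l : ℝ) / k))) * M.favg πs k
      - k * (2 * η * (1 - (1 - 1 / (k : ℝ)) ^ l)) ≤ M.favg πg l := by
    have hπs := M.favg_mem_Icc πs hk'.le
    have hπg := M.favg_mem_Icc πg (Nat.cast_nonneg l)
    -- The induction gives the error on the left; `(1 - 1 / k) ^ l ≤ exp (-l / k)` and `1 ≤ k`
    -- weaken it to the claimed one.
    have h0 : 2 * η * (1 - Real.exp (-((l : ℝ) / k))) ≤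
        k * (2 * η * (1 - (1 - 1 / (k : ℝ)) ^ l)) := by
      have h1 : 2 * η * (1 - Real.exp (-((l : ℝ) / k))) ≤ 2 * η * (1 - (1 - 1 / (k : ℝ)) ^ l) :=
        mul_le_mul_of_nonneg_left (by linarith) (by linarith)
      exact h1.trans (le_mul_of_one_le_left
        ((mul_nonneg (by linarith) (sub_nonneg.2 hexp1)).trans h1) hk1)
    rcases lt_or_ge η 1 with hη1 | hη1
    · have h1 := M.sum_runUtil_greedy_ge hg hk' (δ := 2 * η)
        (Q := fun h => M.runUtil πs h (Fintype.card T) k (Obs.empty T))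
        (fun x ρ hρ hx => M.sum_consistentSet_runUtil_le πs hη hη1 (hS x) hρ hx _ hk'.le)
        (Fintype.card T) (Nat.cast_nonneg l) (Obs.empty T) (Finset.card_le_univ _)
      rw [VoIModel.consistentSet_empty, VoIModel.obsProb_empty, VoIModel.ec2_empty] at h1
      change _ + _ * (M.favg πs k - _) ≤ M.favg πg l at h1
      linarith
    -- For `η ≥ 1` the claim is empty: `favg` is at most `1 / 2`, so the lower bound is not
    -- positive.
    · have h1 : (1 - Real.exp (-((l : ℝ) / k))) * M.favg πs k ≤
          (1 - Real.exp (-((l : ℝ) / k))) * (2 * η) :=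
        mul_le_mul_of_nonneg_left (by linarith [hπs.2]) (sub_nonneg.2 hexp1)
      linarith [hπg.1]
  refine ⟨hfirst, fun hk2 => le_trans ?_ hfirst⟩
  have h2 : (2 : ℝ) ≤ k := by exact_mod_cast hk2
  -- For `k ≥ 2` the second error is the larger one, so its bound follows from the first.
  have hhalf : 1 / (k : ℝ) ≤ 1 - 1 / (k : ℝ) := by
    have : 1 / (k : ℝ) ≤ 1 / 2 := one_div_le_one_div_of_le two_pos h2
    linarith
  have h3 := pow_le_pow_left₀ hinv0 hhalf l
  have h4 : (k : ℝ) * (2 * η * (1 - (1 - 1 / (k : ℝ)) ^ l)) ≤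
      k * (2 * η * (1 - (1 / (k : ℝ)) ^ l)) :=
    mul_le_mul_of_nonneg_left (mul_le_mul_of_nonneg_left (by linarith) (by linarith)) hk'.le
  linarith
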